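/- For countable sets $X,Y$ and finite sets $A,B$, a quantum strategy consists of complex Hilbert spaces $\mathcal H_A,\mathcal H_B$ of arbitrary dimension, a unit vector $|\psi\rangle\in\mathcal H_A\otimes\mathcal H_B$ (Hilbert space tensor product), and projective measurements $\{A_x^a\}_{a\in A}$ on $\mathcal H_A$ for each $x\in X$ and $\{B_y^b\}_{b\in B}$ on $\mathcal H_B$ for each $y\in Y$. Its correlation is $p(a,b|x,y)=\langle\psi|A_x^a\otimes B_y^b|\psi\rangle$. Let $\mathcal C_{qs}^{\infty,\infty,4,3}$ be the set of correlations of all strategies with $X=Y=\mathbb N$, $|A|=4$, $|B|=3$, and for $N\in\mathbb N$ let $\mathcal C_{q\le N}^{\infty,\infty,4,3}$ be the subset of those obtained from a strategy whose state $|\psi\rangle$ has Schmidt rank at most $N$. Put $|p-p'|_{corr}:=\sup_{x,y}\sum_{a,b}|p(a,b|x,y)-p'(a,b|x,y)|$. Theorem. There is a correlation $p^*\in\mathcal C_{qs}^{\infty,\infty,4,3}$ such that, if $p\in\mathcal C_{q\le N}^{\infty,\infty,4,3}$ and $|p-p^*|_{corr}\le\delta$, then $N=\Omega(\delta^{-1/32})$.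 That is, there is a constant $c>0$ such that for all $N\in\mathbb N$, all $\delta>0$ and all $p\in\mathcal C_{q\le N}^{\infty,\infty,4,3}$ with $|p-p^*|_{corr}\le\delta$, one has $N\ge c\,\delta^{-1/32}$. -/

import Mathlib

open scoped TensorProduct ENNReal

universe u v

noncomputable section

/-- The Hilbert space tensor product: the completion of the algebraic tensor product with respect
to the inner product determined by `⟪a ⊗ b, a' ⊗ b'⟫ = ⟪a, a'⟫ * ⟪b, b'⟫`. -/
abbrev HilbertTensor (HA : Type u) (HB : Type v)
    [NormedAddCommGroup HA] [InnerProductSpace ℂ HA]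
    [NormedAddCommGroup HB] [InnerProductSpace ℂ HB] : Type (max u v) :=
  UniformSpace.Completion (HA ⊗[ℂ] HB)

/-- The product vector `a ⊗ b` in the Hilbert space tensor product. -/
def HilbertTensor.tmul {HA : Type u} {HB : Type v}
    [NormedAddCommGroup HA] [InnerProductSpace ℂ HA]
    [NormedAddCommGroup HB] [InnerProductSpace ℂ HB] (a : HA) (b : HB) : HilbertTensor HA HB :=
  ((a ⊗ₜ[ℂ] b : HA ⊗[ℂ] HB) : UniformSpace.Completion (HA ⊗[ℂ] HB))

/-- The bounded operator `S ⊗ T` on the Hilbert space tensor product. -/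
def HilbertTensor.map {HA : Type u} {HB : Type v}
    [NormedAddCommGroup HA] [InnerProductSpace ℂ HA]
    [NormedAddCommGroup HB] [InnerProductSpace ℂ HB]
    (S : HA →L[ℂ] HA) (T : HB →L[ℂ] HB) : HilbertTensor HA HB →L[ℂ] HilbertTensor HA HB :=
  (TensorProduct.mapL S T).completion

/-- `ψ` has Schmidt rank at most `N`: it has a Schmidt decomposition
`ψ = ∑ i, s i • (e i ⊗ f i)`, with positive coefficients `s i` and orthonormal families `e` and
`f`, which has at most `N` terms. -/
def HasSchmidtRankLE {HA : Type u} {HB : Type v}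
    [NormedAddCommGroup HA] [InnerProductSpace ℂ HA]
    [NormedAddCommGroup HB] [InnerProductSpace ℂ HB]
    (ψ : HilbertTensor HA HB) (N : ℕ) : Prop :=
  ∃ r ≤ N, ∃ (s : Fin r → ℝ) (e : Fin r → HA) (f : Fin r → HB),
    (∀ i, 0 < s i) ∧ Orthonormal ℂ e ∧ Orthonormal ℂ f ∧
      ψ = ∑ i, (s i : ℂ) • HilbertTensor.tmul (e i) (f i)

/-- A projective measurement on `H` with finite outcome set `A`: mutually orthogonal orthogonal
projections that sum to the identity. -/
structure ProjectiveMeasurement (A : Type*) [Fintype A] (H : Type u)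
    [NormedAddCommGroup H] [InnerProductSpace ℂ H] [CompleteSpace H] where
  /-- The projection that belongs to an outcome. -/
  proj : A → (H →L[ℂ] H)
  isStarProjection : ∀ a, IsStarProjection (proj a)
  orthogonal : ∀ a a', a ≠ a' → proj a * proj a' = 0
  sum_eq_one : ∑ a, proj a = 1

/-- A quantum strategy on `HA ⊗ HB` with question sets `X`, `Y` and finite answer sets `A`, `B`:
a unit vector together with projective measurements for all questions. -/
structure QuantumStrategy (X Y A B : Type*) [Fintype A] [Fintype B] (HA : Type u) (HB : Type v)
    [NormedAddCommGroup HA] [InnerProductSpace ℂ HA] [CompleteSpace HA]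
    [NormedAddCommGroup HB] [InnerProductSpace ℂ HB] [CompleteSpace HB] where
  /-- The joint state. -/
  state : HilbertTensor HA HB
  norm_state : ‖state‖ = 1
  /-- The measurements of the first party. -/
  measA : X → ProjectiveMeasurement A HA
  /-- The measurements of the second party. -/
  measB : Y → ProjectiveMeasurement B HB

/-- The family `p x y a b = p(a, b | x, y)` is the correlation of the strategy:
`p(a, b | x, y) = ⟨ψ| A_x^a ⊗ B_y^b |ψ⟩`. -/
def QuantumStrategy.Achieves {X Y A B : Type*} [Fintype A] [Fintype B] {HA : Type u} {HB : Type v}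
    [NormedAddCommGroup HA] [InnerProductSpace ℂ HA] [CompleteSpace HA]
    [NormedAddCommGroup HB] [InnerProductSpace ℂ HB] [CompleteSpace HB]
    (S : QuantumStrategy X Y A B HA HB) (p : X → Y → A → B → ℝ) : Prop :=
  ∀ x y a b, (p x y a b : ℂ) =
    inner ℂ S.state (HilbertTensor.map ((S.measA x).proj a) ((S.measB y).proj b) S.state)

/-- `C_qs`: the correlations of quantum strategies on arbitrary Hilbert spaces. -/
def Cqs (X Y A B : Type*) [Fintype A] [Fintype B] : Set (X → Y → A → B → ℝ) :=
  {p | ∃ (HA : Type u) (_ : NormedAddCommGroup HA) (_ : InnerProductSpace ℂ HA)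
      (_ : CompleteSpace HA) (HB : Type v) (_ : NormedAddCommGroup HB)
      (_ : InnerProductSpace ℂ HB) (_ : CompleteSpace HB)
      (S : QuantumStrategy X Y A B HA HB), S.Achieves p}

/-- `C_{q ≤ N}`: the correlations of quantum strategies on arbitrary Hilbert spaces whose state has
Schmidt rank at most `N`. -/
def CqLE (N : ℕ) (X Y A B : Type*) [Fintype A] [Fintype B] : Set (X → Y → A → B → ℝ) :=
  {p | ∃ (HA : Type u) (_ : NormedAddCommGroup HA) (_ : InnerProductSpace ℂ HA)
      (_ : CompleteSpace HA) (HB : Type v) (_ : NormedAddCommGroup HB)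
      (_ : InnerProductSpace ℂ HB) (_ : CompleteSpace HB)
      (S : QuantumStrategy X Y A B HA HB), HasSchmidtRankLE S.state N ∧ S.Achieves p}

/-- The distance `sup_{x, y} ∑_{a, b} |p(a, b | x, y) - p'(a, b | x, y)|`. It takes values in
`[0, ∞]`, so that the supremum always exists. -/
def corrDist {X Y A B : Type*} [Fintype A] [Fintype B] (p p' : X → Y → A → B → ℝ) : ℝ≥0∞ :=
  ⨆ (x : X) (y : Y), ENNReal.ofReal (∑ a, ∑ b, |p x y a b - p' x y a b|)

end

/-! The witness is the state `∑ √(w i) • (e i ⊗ e i)` with `w i = 1 / ((i + 1) (i + 2))`, where on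
question `x` both players test for `e x`. The matrix `p(0, 0 | x, y)` is then diagonal with entries
`w x`, so it has infinite rank. Schmidt rank at most `N` forces this matrix to have rank at most `N
^ 2` (`exists_factorization`), so its corner of size `N ^ 2 + 1` is singular. A singular matrix is
not strictly diagonally dominant, hence `w (N ^ 2) ≤ (N ^ 2 + 1) δ`
(`le_card_mul_of_abs_sub_diagonal_le`). As `w` decays quadratically, this gives `1 / δ ≤ 12 N ^ 6`,
which is stronger than the exponent 32 requires. -/

namespace HilbertTensor

variable {HA : Type u} {HB : Type v}
  [NormedAddCommGroup HA] [InnerProductSpace ℂ HA]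
  [NormedAddCommGroup HB] [InnerProductSpace ℂ HB]

theorem inner_tmul (a a' : HA) (b b' : HB) :
    inner ℂ (tmul a b) (tmul a' b') = inner ℂ a a' * inner ℂ b b' := by
  simp [tmul, UniformSpace.Completion.inner_coe]

theorem map_coe (S : HA →L[ℂ] HA) (T : HB →L[ℂ] HB) (t : HA ⊗[ℂ] HB) :
    map S T (t : HilbertTensor HA HB) = ((TensorProduct.mapL S T t : HA ⊗[ℂ] HB) :) := by
  simp [map]

theorem map_tmul (S : HA →L[ℂ] HA) (T : HB →L[ℂ] HB) (a : HA) (b : HB) :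
    map S T (tmul a b) = tmul (S a) (T b) := by
  rw [tmul, map_coe]
  rfl

theorem zero_tmul (b : HB) : tmul (0 : HA) b = 0 := by
  rw [tmul, TensorProduct.zero_tmul, UniformSpace.Completion.coe_zero]

theorem tmul_zero (a : HA) : tmul a (0 : HB) = 0 := by
  rw [tmul, TensorProduct.tmul_zero, UniformSpace.Completion.coe_zero]

theorem orthonormal_tmul {ι : Type*} {e : ι → HA} {f : ι → HB}
    (he : Orthonormal ℂ e) (hf : Orthonormal ℂ f) : Orthonormal ℂ fun i => tmul (e i) (f i) := by
  classical
  rw [orthonormal_iff_ite] at *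
  intro i j
  rw [inner_tmul, he, hf]
  split_ifs <;> simp

theorem inner_map_left {S : HA →L[ℂ] HA} {T : HB →L[ℂ] HB}
    (hS : S.IsSymmetric) (hT : T.IsSymmetric) (x y : HilbertTensor HA HB) :
    inner ℂ (map S T x) y = inner ℂ x (map S T y) := by
  induction x, y using UniformSpace.Completion.induction_on₂ with
  | hp => exact isClosed_eq (by fun_prop) (by fun_prop)
  | ih x y =>
    simp only [map_coe, UniformSpace.Completion.inner_coe]
    induction x using TensorProduct.induction_on with
    | zero => simp
    | add x x' hx hx' => simp only [map_add, inner_add_left, hx, hx']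
    | tmul a b =>
      induction y using TensorProduct.induction_on with
      | zero => simp
      | add y y' hy hy' => simp only [map_add, inner_add_right, hy, hy']
      | tmul a' b' =>
        change inner ℂ (S a ⊗ₜ[ℂ] T b) (a' ⊗ₜ[ℂ] b') = inner ℂ (a ⊗ₜ[ℂ] b) (S a' ⊗ₜ[ℂ] T b')
        rw [TensorProduct.inner_tmul, TensorProduct.inner_tmul]
        exact congrArg₂ _ (hS a a') (hT b b')

end HilbertTensor

theorem ProjectiveMeasurement.isSymmetric_proj {A : Type*} [Fintype A] {H : Type u}
    [NormedAddCommGroup H] [InnerProductSpace ℂ H] [CompleteSpace H]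
    (m : ProjectiveMeasurement A H) (a : A) : (m.proj a).IsSymmetric :=
  (m.isStarProjection a).isSelfAdjoint.isSymmetric

/-- The two-outcome measurement of a projection `P`, viewed as a measurement with `n + 2`
outcomes: outcome `0` belongs to `P` and outcome `1` to `1 - P`. -/
noncomputable def ProjectiveMeasurement.ofStarProjection (n : ℕ) {H : Type u}
    [NormedAddCommGroup H] [InnerProductSpace ℂ H] [CompleteSpace H]
    {P : H →L[ℂ] H} (hP : IsStarProjection P) : ProjectiveMeasurement (Fin (n + 2)) H where
  proj := Fin.cons P (Fin.cons (1 - P) fun _ => 0)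
  isStarProjection a := by
    refine Fin.cases hP (fun a => Fin.cases hP.one_sub (fun a => ?_) a) a
    exact IsStarProjection.zero _
  orthogonal a a' := by
    have h : P * P = P := hP.isIdempotentElem
    refine Fin.cases ?_ (fun a => Fin.cases ?_ (fun a => ?_) a) a <;>
      refine Fin.cases ?_ (fun a' => Fin.cases ?_ (fun a' => ?_) a') a' <;>
      simp [mul_sub, sub_mul, h]
  sum_eq_one := by
    simp [Fin.sum_univ_succ]

/-- The numbers `p(a, b | x, y)` of a strategy. -/
noncomputable def QuantumStrategy.correlation {X Y A B : Type*} [Fintype A] [Fintype B] {HA : Type u}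
    {HB : Type v} [NormedAddCommGroup HA] [InnerProductSpace ℂ HA] [CompleteSpace HA]
    [NormedAddCommGroup HB] [InnerProductSpace ℂ HB] [CompleteSpace HB]
    (S : QuantumStrategy X Y A B HA HB) (x : X) (y : Y) (a : A) (b : B) : ℝ :=
  (inner ℂ S.state (HilbertTensor.map ((S.measA x).proj a) ((S.measB y).proj b) S.state)).re

/-- The inner product is already real, since a tensor product of symmetric operators is symmetric;
taking the real part loses nothing. -/
theorem QuantumStrategy.achieves_correlation {X Y A B : Type*} [Fintype A] [Fintype B]
    {HA : Type u} {HB : Type v} [NormedAddCommGroup HA] [InnerProductSpace ℂ HA] [CompleteSpace HA]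
    [NormedAddCommGroup HB] [InnerProductSpace ℂ HB] [CompleteSpace HB]
    (S : QuantumStrategy X Y A B HA HB) : S.Achieves S.correlation := by
  intro x y a b
  refine Complex.conj_eq_iff_re.mp ?_
  rw [inner_conj_symm, HilbertTensor.inner_map_left] <;>
    exact ProjectiveMeasurement.isSymmetric_proj _ _

/-! ### Low Schmidt rank and closeness of correlations -/

/-- For a state of Schmidt rank at most `N` and fixed answers, the matrix of the numbers
`p(a, b | x, y)` factors through a space of dimension at most `N ^ 2`. -/
theorem QuantumStrategy.Achieves.exists_factorization {X Y A B : Type*} [Fintype A] [Fintype B]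
    {HA : Type u} {HB : Type v} [NormedAddCommGroup HA] [InnerProductSpace ℂ HA] [CompleteSpace HA]
    [NormedAddCommGroup HB] [InnerProductSpace ℂ HB] [CompleteSpace HB]
    {S : QuantumStrategy X Y A B HA HB} {p : X → Y → A → B → ℝ} (hp : S.Achieves p) {N : ℕ}
    (hN : HasSchmidtRankLE S.state N) (a : A) (b : B) :
    ∃ r ≤ N, ∃ (F : X → Fin r × Fin r → ℂ) (G : Fin r × Fin r → Y → ℂ),
      ∀ x y, (p x y a b : ℂ) = ∑ t, F x t * G t y := by
  obtain ⟨r, hr, s, e, f, -, -, -, hψ⟩ := hN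
  -- Expanding `ψ` on both sides of the inner product gives one term per pair of Schmidt indices,
  -- and each term splits into a factor in `x` and a factor in `y`.
  refine ⟨r, hr, fun x t => s t.1 * s t.2 * inner ℂ (e t.1) ((S.measA x).proj a (e t.2)),
    fun t y => inner ℂ (f t.1) ((S.measB y).proj b (f t.2)), fun x y => ?_⟩
  rw [hp, hψ, Fintype.sum_prod_type]
  simp only [map_sum, map_smul, HilbertTensor.map_tmul, sum_inner, inner_sum, inner_smul_left,
    inner_smul_right, HilbertTensor.inner_tmul, Complex.conj_ofReal]
  simp only [Finset.mul_sum]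
  rw [Finset.sum_comm]
  refine Finset.sum_congr rfl fun i _ => Finset.sum_congr rfl fun j _ => ?_
  ring

/-- Excludes `N = 0`, so that additive constants can be absorbed into powers of `N`. -/
theorem HasSchmidtRankLE.one_le {HA : Type u} {HB : Type v}
    [NormedAddCommGroup HA] [InnerProductSpace ℂ HA]
    [NormedAddCommGroup HB] [InnerProductSpace ℂ HB] {ψ : HilbertTensor HA HB} {N : ℕ}
    (h : HasSchmidtRankLE ψ N) (hψ : ‖ψ‖ = 1) : 1 ≤ N := by
  obtain ⟨r, hr, s, e, f, -, -, -, h⟩ := h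
  by_contra! hN
  obtain rfl : r = 0 := by omega
  simp [h] at hψ

theorem abs_sub_le_of_corrDist_le {X Y A B : Type*} [Fintype A] [Fintype B]
    {p p' : X → Y → A → B → ℝ} {δ : ℝ} (hδ : 0 ≤ δ) (h : corrDist p p' ≤ ENNReal.ofReal δ)
    (x : X) (y : Y) (a : A) (b : B) : |p x y a b - p' x y a b| ≤ δ := by
  have h₁ : ENNReal.ofReal (∑ a, ∑ b, |p x y a b - p' x y a b|) ≤ ENNReal.ofReal δ :=
    (le_iSup₂ (f := fun x y => ENNReal.ofReal (∑ a, ∑ b, |p x y a b - p' x y a b|)) x y).trans h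
  calc |p x y a b - p' x y a b|
      ≤ ∑ b, |p x y a b - p' x y a b| :=
        Finset.single_le_sum (f := fun b => |p x y a b - p' x y a b|)
          (fun _ _ => abs_nonneg _) (Finset.mem_univ b)
    _ ≤ ∑ a, ∑ b, |p x y a b - p' x y a b| :=
        Finset.single_le_sum (f := fun a => ∑ b, |p x y a b - p' x y a b|)
          (fun _ _ => Finset.sum_nonneg fun _ _ => abs_nonneg _) (Finset.mem_univ a)
    _ ≤ δ := (ENNReal.ofReal_le_ofReal_iff hδ).mp h₁

/-! ### Low-rank matrices near diagonal ones -/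

/-- A square matrix that factors through a space of smaller dimension has determinant zero. -/
theorem Matrix.det_mul_eq_zero_of_card_lt {m n K : Type*} [Fintype m] [DecidableEq m] [Fintype n]
    [Field K] (A : Matrix m n K) (B : Matrix n m K) (h : Fintype.card n < Fintype.card m) :
    (A * B).det = 0 := by
  by_contra hdet
  have h₁ : (A * B).rank = Fintype.card m :=
    Matrix.rank_of_isUnit _ ((Matrix.isUnit_iff_isUnit_det _).mpr (Ne.isUnit hdet))
  have h₂ := (Matrix.rank_mul_le_left A B).trans A.rank_le_card_width
  omega

/-- A matrix of low rank is not entrywise close to a diagonal matrix with large entries. -/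
theorem le_card_mul_of_abs_sub_diagonal_le {m n : Type*} [Fintype m] [DecidableEq m] [Fintype n]
    (A : Matrix m n ℂ) (B : Matrix n m ℂ) (h : Fintype.card n < Fintype.card m)
    {d : m → ℝ} {w δ : ℝ} (hd : ∀ i, w ≤ d i)
    (hδ : ∀ i j, ‖(A * B) i j - (if i = j then (d i : ℂ) else 0)‖ ≤ δ) :
    w ≤ Fintype.card m * δ := by
  by_contra! hlt
  -- If `w > card m * δ`, each diagonal entry has norm at least `w - δ`, which exceeds the bound
  -- `(card m - 1) * δ` on the rest of its row.
  refine det_ne_zero_of_sum_row_lt_diag (A := A * B) (fun k => ?_)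
    (Matrix.det_mul_eq_zero_of_card_lt A B h)
  have hdiag : d k - ‖(A * B) k k‖ ≤ δ := by
    have h₁ := hδ k k
    rw [if_pos rfl, norm_sub_rev] at h₁
    have h₂ := norm_sub_norm_le (d k : ℂ) ((A * B) k k)
    have h₃ : d k ≤ ‖(d k : ℂ)‖ := by simpa using le_abs_self (d k)
    linarith
  have hoff : ∑ j ∈ Finset.univ.erase k, ‖(A * B) k j‖ ≤ (Fintype.card m - 1) * δ := by
    have hcard : ((Finset.univ.erase k).card : ℝ) = Fintype.card m - 1 := by
      rw [Finset.card_erase_of_mem (Finset.mem_univ k), Finset.card_univ,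
        Nat.cast_sub (Fintype.card_pos_iff.mpr ⟨k⟩), Nat.cast_one]
    rw [← hcard, ← nsmul_eq_mul]
    refine Finset.sum_le_card_nsmul _ _ _ fun j hj => ?_
    have h₁ := hδ k j
    rwa [if_neg (Finset.ne_of_mem_erase hj).symm, sub_zero] at h₁
  linarith [hd k]

/-! ### The diagonal correlation -/

/-- A probability distribution on `ℕ` with quadratic decay. -/
noncomputable def quadraticWeight (i : ℕ) : ℝ := 1 / ((i + 1) * (i + 2))

theorem quadraticWeight_pos (i : ℕ) : 0 < quadraticWeight i := by
  unfold quadraticWeight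
  positivity

theorem quadraticWeight_antitone : Antitone quadraticWeight := by
  intro i j hij
  have h : (i : ℝ) ≤ j := by exact_mod_cast hij
  unfold quadraticWeight
  gcongr

theorem hasSum_quadraticWeight : HasSum quadraticWeight 1 := by
  have h (n : ℕ) : ∑ i ∈ Finset.range n, quadraticWeight i = 1 - 1 / ((n : ℝ) + 1) := by
    induction n with
    | zero => simp
    | succ n ih =>
      rw [Finset.sum_range_succ, ih, quadraticWeight]
      push_cast
      field_simp
      ring
  rw [hasSum_iff_tendsto_nat_of_nonneg fun i => (quadraticWeight_pos i).le]
  simp only [h]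
  simpa using (tendsto_const_nhds (x := (1 : ℝ))).sub tendsto_one_div_add_atTop_nhds_zero_nat

/-- Unit vectors with prescribed squared coefficients in an orthonormal family. -/
theorem Orthonormal.exists_hasSum_sqrt_smul {ι E : Type*} [NormedAddCommGroup E]
    [InnerProductSpace ℂ E] [CompleteSpace E] {v : ι → E} (hv : Orthonormal ℂ v) {w : ι → ℝ}
    (hw₀ : ∀ i, 0 ≤ w i) (hw : HasSum w 1) :
    ∃ ψ : E, ‖ψ‖ = 1 ∧ HasSum (fun i => (√(w i) : ℂ) • v i) ψ ∧
      ∀ i, inner ℂ ψ (v i) = (√(w i) : ℂ) := by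
  classical
  have hsum : Summable fun i => (√(w i) : ℂ) • v i := by
    have h := hv.orthogonalFamily.summable_iff_norm_sq_summable fun i => (√(w i) : ℂ)
    refine h.mpr ?_
    simpa [Real.sq_sqrt (hw₀ _)] using hw.summable
  obtain ⟨ψ, hψ⟩ := hsum
  have hinner (i : ι) : inner ℂ ψ (v i) = (√(w i) : ℂ) := by
    have h₁ : HasSum (fun j => inner ℂ (v i) ((√(w j) : ℂ) • v j)) (inner ℂ (v i) ψ) :=
      hψ.mapL (innerSL ℂ (v i))
    have h₂ : inner ℂ (v i) ψ = (√(w i) : ℂ) := by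
      refine h₁.unique ?_
      convert hasSum_ite_eq i (√(w i) : ℂ) using 2 with j
      rw [inner_smul_right, orthonormal_iff_ite.mp hv]
      rcases eq_or_ne i j with rfl | hij
      · simp
      · simp [hij, hij.symm]
    rw [← inner_conj_symm, h₂, Complex.conj_ofReal]
  refine ⟨ψ, ?_, hψ, hinner⟩
  have h₁ : HasSum (fun j => inner ℂ ψ ((√(w j) : ℂ) • v j)) (inner ℂ ψ ψ) :=
    hψ.mapL (innerSL ℂ ψ)
  have h₂ : inner ℂ ψ ψ = ((1 : ℝ) : ℂ) := by
    refine h₁.unique ?_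
    convert Complex.hasSum_ofReal.mpr hw using 2 with j
    rw [inner_smul_right, hinner, ← Complex.ofReal_mul, Real.mul_self_sqrt (hw₀ j)]
  have h₃ : ‖ψ‖ ^ 2 = 1 := by
    rw [← inner_self_eq_norm_sq (𝕜 := ℂ), h₂]
    simp
  exact (pow_eq_one_iff_of_nonneg (norm_nonneg ψ) two_ne_zero).mp h₃

/-- For every distribution `w` on `ℕ` there is a strategy in which both players answer `0` with
probability `w x` if they are asked the same question `x`, and never if they are asked distinct
questions. -/
theorem exists_correlation_eq_diagonal (m n : ℕ) {w : ℕ → ℝ} (hw₀ : ∀ i, 0 ≤ w i)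
    (hw : HasSum w 1) :
    ∃ p ∈ Cqs.{0, 0} ℕ ℕ (Fin (m + 2)) (Fin (n + 2)),
      ∀ x y, p x y 0 0 = if x = y then w x else 0 := by
  obtain ⟨e, he⟩ : ∃ e : ℕ → lp (fun _ : ℕ => ℂ) 2, Orthonormal ℂ e :=
    ⟨_, (default : HilbertBasis ℕ ℂ (lp (fun _ : ℕ => ℂ) 2)).orthonormal⟩
  obtain ⟨ψ, hnorm, hψ, hinner⟩ :=
    (HilbertTensor.orthonormal_tmul he he).exists_hasSum_sqrt_smul hw₀ hw
  let P (x : ℕ) := (ℂ ∙ e x).starProjection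
  have hP (x : ℕ) : IsStarProjection (P x) := isStarProjection_starProjection
  have hPe (x i : ℕ) : P x (e i) = if i = x then e i else 0 := by
    rw [Submodule.starProjection_unit_singleton ℂ (he.1 x), orthonormal_iff_ite.mp he]
    split_ifs <;> simp_all
  let S : QuantumStrategy ℕ ℕ (Fin (m + 2)) (Fin (n + 2)) (lp (fun _ : ℕ => ℂ) 2)
      (lp (fun _ : ℕ => ℂ) 2) :=
    { state := ψ
      norm_state := hnorm
      measA := fun x => .ofStarProjection m (hP x)
      measB := fun y => .ofStarProjection n (hP y) }
  refine ⟨S.correlation, ⟨_, _, _, _, _, _, _, _, S, S.achieves_correlation⟩, fun x y => ?_⟩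
  have hmap : HilbertTensor.map (P x) (P y) ψ =
      if x = y then (√(w x) : ℂ) • HilbertTensor.tmul (e x) (e x) else 0 := by
    refine (hψ.mapL (HilbertTensor.map (P x) (P y))).unique ?_
    -- The projections kill the `i`-th term unless `i = x` and `i = y`.
    convert hasSum_ite_eq x
      (if x = y then (√(w x) : ℂ) • HilbertTensor.tmul (e x) (e x) else 0) using 2 with i
    rw [map_smul, HilbertTensor.map_tmul, hPe, hPe]
    split_ifs <;> simp_all [HilbertTensor.zero_tmul, HilbertTensor.tmul_zero]
  change (inner ℂ ψ (HilbertTensor.map (P x) (P y) ψ)).re = _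
  rw [hmap]
  split_ifs
  · rw [inner_smul_right, hinner, ← Complex.ofReal_mul, Real.mul_self_sqrt (hw₀ x),
      Complex.ofReal_re]
  · simp

/-! ### The lower bound -/

theorem theorem2 :
    ∃ pstar ∈ Cqs.{0, 0} ℕ ℕ (Fin 4) (Fin 3), ∃ c : ℝ, 0 < c ∧
      ∀ (N : ℕ) (δ : ℝ), 0 < δ →
        ∀ p ∈ CqLE.{u, v} N ℕ ℕ (Fin 4) (Fin 3), corrDist p pstar ≤ ENNReal.ofReal δ →
          c * (1 / δ ^ (1 / 32 : ℝ)) ≤ (N : ℝ) := by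
  obtain ⟨pstar, hmem, hpstar⟩ := exists_correlation_eq_diagonal 2 1
    (fun i => (quadraticWeight_pos i).le) hasSum_quadraticWeight
  refine ⟨pstar, hmem, 1 / 12, by norm_num, fun N δ hδ p hp hdist => ?_⟩
  obtain ⟨HA, _, _, _, HB, _, _, _, S, hrank, hS⟩ := hp
  have hN : (1 : ℝ) ≤ N := by exact_mod_cast hrank.one_le S.norm_state
  obtain ⟨r, hr, F, G, hFG⟩ := hS.exists_factorization hrank 0 0
  -- One row more than the rank bound allows; the last index `N ^ 2` carries the smallest weight.
  have hweight : quadraticWeight (N ^ 2) ≤ Fintype.card (Fin (N ^ 2 + 1)) * δ := by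
    refine le_card_mul_of_abs_sub_diagonal_le (d := fun i => quadraticWeight i)
      (Matrix.of fun (i : Fin (N ^ 2 + 1)) t => F i t)
      (Matrix.of fun t (j : Fin (N ^ 2 + 1)) => G t j) ?_
      (fun i => quadraticWeight_antitone (Nat.lt_succ_iff.mp i.2)) fun i j => ?_
    · simp only [Fintype.card_prod, Fintype.card_fin]
      nlinarith
    · have h := abs_sub_le_of_corrDist_le hδ.le hdist i j 0 0
      rw [hpstar] at h
      rw [Matrix.mul_apply]
      simp only [Matrix.of_apply]
      rw [← hFG, ← Real.norm_eq_abs, ← Complex.norm_real] at *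
      convert h using 2
      simp only [Fin.ext_iff]
      split_ifs <;> simp
  have hinv : 1 / δ ≤ (12 * N : ℝ) ^ 32 := by
    rw [Fintype.card_fin, quadraticWeight, div_le_iff₀ (by positivity)] at hweight
    rw [div_le_iff₀ hδ]
    refine hweight.trans ?_
    push_cast
    have h₂ : (1 : ℝ) ≤ (N : ℝ) ^ 2 := one_le_pow₀ hN
    calc ((N : ℝ) ^ 2 + 1) * δ * (((N : ℝ) ^ 2 + 1) * ((N : ℝ) ^ 2 + 2))
        ≤ (2 * (N : ℝ) ^ 2) * δ * ((2 * (N : ℝ) ^ 2) * (3 * (N : ℝ) ^ 2)) := by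
          gcongr <;> linarith
      _ = 12 * (N : ℝ) ^ 6 * δ := by ring
      -- Deliberately lossy: raising `12` to the power 32 as well makes the root exactly `12 * N`,
      -- whence `c = 1 / 12`.
      _ ≤ (12 : ℝ) ^ 32 * (N : ℝ) ^ 32 * δ := by
          gcongr
          · norm_num
          · norm_num
      _ = (12 * N : ℝ) ^ 32 * δ := by rw [mul_pow]
  have hroot : 1 / δ ^ (1 / 32 : ℝ) ≤ 12 * N := by
    calc 1 / δ ^ (1 / 32 : ℝ) = (1 / δ) ^ (1 / 32 : ℝ) := by
          rw [Real.div_rpow zero_le_one hδ.le, Real.one_rpow]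
      _ ≤ ((12 * N : ℝ) ^ 32) ^ (1 / 32 : ℝ) :=
          Real.rpow_le_rpow (by positivity) hinv (by norm_num)
      _ = 12 * N := by
          rw [← Real.rpow_natCast, ← Real.rpow_mul (by positivity)]
          norm_num
  linarith
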